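/- Recall that the crank of a partition is its largest part if $1$ is not a part, and otherwise is the number of parts larger than $\omega$ minus $\omega$, where $\omega\ge 1$ is the number of parts equal to $1$. For $n\ne 1$ let $M(m,n)$ be the number of partitions of $n$ with crank $m$; for $n=1$ put $M(-1,1)=1$, $M(0,1)=-1$, $M(1,1)=1$ and $M(m,1)=0$ for all other $m$. For $j\ge 1$ the $j$-th symmetrized crank moment is $$\mu_j(n)=\sum_{m=-n}^{n}\binom{m+\lfloor\frac{j-1}{2}\rfloor}{j}M(m,n),\qquad \binom{x}{j}=\frac{x(x-1)\cdots(x-j+1)}{j!}.$$ Write $(q)_\infty=\prod_{n\ge 1}(1-q^n)$. **Theorem.** Let $k\ge 1$ be an integer and let $q$ be a complex number with $|q|<1$. Then the product $(q)_\infty$ converges to a nonzero value, the series below converge absolutely, and $$\sum_{n=1}^{\infty}\mu_{2k}(n)\,q^n=\frac{1}{(q)_\infty}\sum_{n=1}^{\infty}(-1)^{n-1}q^{n(n-1)/2+kn}\,\frac{1+q^n}{(1-q^n)^{2k}}.$$ If moreover $q\ne 0$, then also the two-sided series below converges absolutely and $$\sum_{n=1}^{\infty}\mu_{2k}(n)\,q^n=\frac{1}{(q)_\infty}\sum_{\substack{n=-\infty\\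 n\neq 0}}^{\infty}\frac{(-1)^{n-1}q^{n(n+1)/2+kn}}{(1-q^n)^{2k}}.$$ -/

import Mathlib

/-- The crank of a partition: if `1` is not a part, it is the largest part; otherwise it is the
number of parts larger than `ω` minus `ω`, where `ω` is the number of parts equal to `1`.
(The largest part of the empty partition is read as `0`.) -/
def crank {n : ℕ} (p : n.Partition) : ℤ :=
  if 1 ∈ p.parts then
    (p.parts.countP (fun i => p.parts.count 1 < i) : ℤ) - (p.parts.count 1 : ℤ)
  else
    (p.parts.sup : ℤ)

/-- `crankCount m n` is `M(m, n)`: the number of partitions of `n` with crank `m` if `n ≠ 1`,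
while `M(-1, 1) = 1`, `M(0, 1) = -1`, `M(1, 1) = 1` and `M(m, 1) = 0` for all other `m`. -/
def crankCount (m : ℤ) (n : ℕ) : ℤ :=
  if n = 1 then
    if m = -1 then 1 else if m = 0 then -1 else if m = 1 then 1 else 0
  else
    ((Finset.univ.filter (fun p : n.Partition => crank p = m)).card : ℤ)

/-- The `k`-th symmetrized crank moment
`μ_k(n) = ∑_{m = -n}^{n} binom(m + ⌊(k - 1) / 2⌋, k) M(m, n)`. The binomial coefficient is the
generalized one, `x (x - 1) ⋯ (x - k + 1) / k!`, and integer division by `2` is the floor. -/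
noncomputable def symCrankMoment (k n : ℕ) : ℤ :=
  ∑ m ∈ Finset.Icc (-(n : ℤ)) (n : ℤ),
    Ring.choose (m + ((k : ℤ) - 1) / 2) k * crankCount m n

/-- `(q)_∞ = ∏_{n ≥ 1} (1 - q ^ n)`, for `‖q‖ < 1`. -/
noncomputable def eulerProd (q : ℂ) : ℂ :=
  ∏' n : ℕ+, (1 - q ^ (n : ℕ))

/-!
Sort the partitions by the number `a` of ones and by the number `b` of parts larger than `a` (for
`a = 0`, by the largest part `b`), so that the crank is `b - a`. The partitions with given `(a, b)`
have generating function `(1 - q) q ^ (a b + a + b) / ((q)_a (q)_b)`, except for `(0, 0)` and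
`(0, 1)`, and these two exceptions are exactly what the convention for `M(m, 1)` corrects. Summing
over `b - a = m` gives a Durfee-type series, which contiguous relations, iterated to the limit,
evaluate as a difference of partial theta series divided by `(q)_∞`: this is the Andrews-Garvan
generating function of `M(m, n)`. Weighting it by the binomial coefficients, exchanging the
summations and applying the binomial series to the sum over `m` leaves a Lambert series in `n`,
whose two-sided form pairs the indices `n` and `-n`.
-/

open Filter Topology

/-- The finite product `(q)_n = ∏_{i = 1}^{n} (1 - q ^ i)`. -/
def qPochhammer {R : Type*} [CommRing R] (q : R) (n : ℕ) : R :=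
  ∏ i ∈ Finset.range n, (1 - q ^ (i + 1))

/-- The infinite product `(q)_∞ = ∏_{n ≥ 1} (1 - q ^ n)` over any topological ring; over `ℂ` it is
`eulerProd`. -/
noncomputable def qPochhammerInf {R : Type*} [CommRing R] [TopologicalSpace R] (q : R) : R :=
  ∏' n : ℕ+, (1 - q ^ (n : ℕ))

@[simp]
lemma qPochhammer_zero {R : Type*} [CommRing R] (q : R) : qPochhammer q 0 = 1 :=
  Finset.prod_range_zero _

lemma qPochhammer_succ {R : Type*} [CommRing R] (q : R) (n : ℕ) :
    qPochhammer q (n + 1) = qPochhammer q n * (1 - q ^ (n + 1)) :=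
  Finset.prod_range_succ _ _

section NormedField

variable {K : Type*} [NormedField K] {q : K}

lemma norm_pow_lt_one (hq : ‖q‖ < 1) {n : ℕ} (hn : n ≠ 0) : ‖q ^ n‖ < 1 := by
  rw [norm_pow]
  exact pow_lt_one₀ (norm_nonneg _) hq hn

lemma norm_pow_le_norm_pow (hq : ‖q‖ < 1) {m n : ℕ} (h : m ≤ n) : ‖q ^ n‖ ≤ ‖q‖ ^ m := by
  rw [norm_pow]
  exact pow_le_pow_of_le_one (norm_nonneg _) hq.le h

lemma one_sub_pow_ne_zero (hq : ‖q‖ < 1) {n : ℕ} (hn : n ≠ 0) : 1 - q ^ n ≠ 0 := by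
  intro h
  have := norm_pow_lt_one hq hn
  rw [← sub_eq_zero.mp h, norm_one] at this
  exact lt_irrefl _ this

lemma qPochhammer_ne_zero (hq : ‖q‖ < 1) (n : ℕ) : qPochhammer q n ≠ 0 :=
  Finset.prod_ne_zero_iff.mpr fun i _ => one_sub_pow_ne_zero hq i.succ_ne_zero

lemma summable_norm_pow_succ (hq : ‖q‖ < 1) : Summable fun i : ℕ => ‖-q ^ (i + 1)‖ := by
  simp only [norm_neg, norm_pow]
  exact (summable_nat_add_iff 1).mpr (summable_geometric_of_lt_one (norm_nonneg _) hq)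

section Complete

variable [CompleteSpace K]

lemma multipliable_one_sub_pow_succ (hq : ‖q‖ < 1) :
    Multipliable fun i : ℕ => 1 - q ^ (i + 1) := by
  simp only [sub_eq_add_neg]
  exact multipliable_one_add_of_summable (summable_norm_pow_succ hq)

lemma multipliable_one_sub_pow_pnat (hq : ‖q‖ < 1) :
    Multipliable fun n : ℕ+ => 1 - q ^ (n : ℕ) :=
  (multipliable_pnat_iff_multipliable_succ (f := fun n => 1 - q ^ n)).mpr
    (multipliable_one_sub_pow_succ hq)

lemma tendsto_qPochhammer (hq : ‖q‖ < 1) :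
    Tendsto (qPochhammer q) atTop (𝓝 (qPochhammerInf q)) := by
  rw [qPochhammerInf, tprod_pnat_eq_tprod_succ (f := fun n => 1 - q ^ n)]
  exact (multipliable_one_sub_pow_succ hq).hasProd.tendsto_prod_nat

lemma qPochhammerInf_ne_zero (hq : ‖q‖ < 1) : qPochhammerInf q ≠ 0 := by
  rw [qPochhammerInf, tprod_pnat_eq_tprod_succ (f := fun n => 1 - q ^ n)]
  simp only [sub_eq_add_neg]
  refine tprod_one_add_ne_zero_of_summable (fun i => ?_) (summable_norm_pow_succ hq)
  rw [← sub_eq_add_neg]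
  exact one_sub_pow_ne_zero hq i.succ_ne_zero

lemma tendsto_inv_qPochhammer (hq : ‖q‖ < 1) :
    Tendsto (fun n => (qPochhammer q n)⁻¹) atTop (𝓝 (qPochhammerInf q)⁻¹) :=
  (tendsto_qPochhammer hq).inv₀ (qPochhammerInf_ne_zero hq)

lemma exists_norm_inv_qPochhammer_le (hq : ‖q‖ < 1) :
    ∃ C : ℝ, 0 ≤ C ∧ ∀ n, ‖(qPochhammer q n)⁻¹‖ ≤ C := by
  obtain ⟨C, hC⟩ :=
    (Metric.isBounded_range_of_tendsto _ (tendsto_inv_qPochhammer hq)).exists_norm_le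
  have h : ∀ n, ‖(qPochhammer q n)⁻¹‖ ≤ C := fun n => hC _ ⟨n, rfl⟩
  exact ⟨C, (norm_nonneg _).trans (h 0), h⟩

end Complete

lemma le_mul_succ_div_two (n : ℕ) : n ≤ n * (n + 1) / 2 := by
  rw [Nat.le_div_iff_mul_le two_pos]
  rcases n with _ | n
  · simp
  · nlinarith

lemma succ_mul_add_two_div_two (n : ℕ) :
    (n + 1) * (n + 1 + 1) / 2 = n * (n + 1) / 2 + (n + 1) := by
  rw [show (n + 1) * (n + 1 + 1) = n * (n + 1) + 2 * (n + 1) by ring,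
    Nat.add_mul_div_left _ _ two_pos]

lemma norm_neg_one_pow_mul_pow_le (hq : ‖q‖ < 1) (m n : ℕ) :
    ‖(-1) ^ n * q ^ (n * (n + 1) / 2 + m)‖ ≤ ‖q‖ ^ n := by
  rw [norm_mul, norm_pow, norm_neg, norm_one, one_pow, one_mul]
  exact norm_pow_le_norm_pow hq ((le_mul_succ_div_two n).trans (Nat.le_add_right _ _))

/-- The partial theta series `∑_{n ≥ 0} (-1) ^ n q ^ (n (n + 1) / 2 + n m)`. -/
noncomputable def partialTheta (q : K) (m : ℕ) : K :=
  ∑' n : ℕ, (-1) ^ n * q ^ (n * (n + 1) / 2 + n * m)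

lemma norm_partialTheta_le (hq : ‖q‖ < 1) (m : ℕ) : ‖partialTheta q m‖ ≤ (1 - ‖q‖)⁻¹ :=
  tsum_of_norm_bounded (hasSum_geometric_of_lt_one (norm_nonneg _) hq) fun n =>
    norm_neg_one_pow_mul_pow_le hq (n * m) n

/-- The general term of `∑ₐ q ^ (a ^ 2 + a s) / ((q)_a (q)_{a + m})`. -/
def durfeeTerm (q : K) (m s a : ℕ) : K :=
  q ^ (a * a + a * s) * ((qPochhammer q a)⁻¹ * (qPochhammer q (a + m))⁻¹)

/-- The series `∑ₐ q ^ (a ^ 2 + a s) / ((q)_a (q)_{a + m})`. For `s = m` it counts partitions by the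
size of their Durfee rectangle, and for `s = m + 2` it is, up to an elementary factor, the
generating function of the partitions of crank `m`. -/
noncomputable def durfeeSum (q : K) (m s : ℕ) : K := ∑' a, durfeeTerm q m s a

lemma norm_durfeeTerm_le (hq : ‖q‖ < 1) {C : ℝ} (hC : 0 ≤ C)
    (h : ∀ n, ‖(qPochhammer q n)⁻¹‖ ≤ C) {m s a j : ℕ} (hj : j ≤ a * a + a * s) :
    ‖durfeeTerm q m s a‖ ≤ ‖q‖ ^ j * (C * C) := by
  rw [durfeeTerm, norm_mul, norm_mul]
  gcongr
  · exact norm_pow_le_norm_pow hq hj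
  · exact h _
  · exact h _

lemma le_mul_self_add_mul (a s : ℕ) : a ≤ a * a + a * s :=
  (Nat.le_mul_self a).trans (Nat.le_add_right _ _)

lemma eq_zero_of_eq_mul_succ {D c : ℕ → K} {r B : ℝ} (hr : r < 1) (hc : ∀ m, ‖c m‖ ≤ r)
    (hB : ∀ m, ‖D m‖ ≤ B) (h : ∀ m, D m = c m * D (m + 1)) (m : ℕ) : D m = 0 := by
  have hr0 : 0 ≤ r := (norm_nonneg _).trans (hc 0)
  have hpow : ∀ n m, ‖D m‖ ≤ r ^ n * B := by
    intro n
    induction n with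
    | zero => simpa using hB
    | succ n ih =>
      intro m
      rw [h m, norm_mul, pow_succ', mul_assoc]
      exact mul_le_mul (hc m) (ih _) (norm_nonneg _) hr0
  have hlim : Tendsto (fun n => r ^ n * B) atTop (𝓝 0) := by
    simpa using (tendsto_pow_atTop_nhds_zero_of_lt_one hr0 hr).mul_const B
  exact norm_le_zero_iff.mp (ge_of_tendsto' hlim fun n => hpow n m)

variable [CompleteSpace K]

lemma summable_durfeeTerm (hq : ‖q‖ < 1) (m s : ℕ) : Summable (durfeeTerm q m s) := by
  obtain ⟨C, hC, h⟩ := exists_norm_inv_qPochhammer_le hq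
  exact Summable.of_norm_bounded
    ((summable_geometric_of_lt_one (norm_nonneg _) hq).mul_right _)
    fun a => norm_durfeeTerm_le hq hC h (le_mul_self_add_mul a s)

lemma exists_norm_durfeeSum_le (hq : ‖q‖ < 1) : ∃ C : ℝ, ∀ m s, ‖durfeeSum q m s‖ ≤ C := by
  obtain ⟨C, hC, h⟩ := exists_norm_inv_qPochhammer_le hq
  exact ⟨_, fun m s => tsum_of_norm_bounded
    ((summable_geometric_of_lt_one (norm_nonneg _) hq).mul_right _).hasSum
    fun a => norm_durfeeTerm_le hq hC h (le_mul_self_add_mul a s)⟩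

lemma durfeeSum_succ_right (hq : ‖q‖ < 1) (m s : ℕ) :
    durfeeSum q m (s + 1) = durfeeSum q m s - q ^ (s + 1) * durfeeSum q (m + 1) (s + 2) := by
  have hterm : ∀ a, durfeeTerm q m (s + 1) (a + 1) =
      durfeeTerm q m s (a + 1) - q ^ (s + 1) * durfeeTerm q (m + 1) (s + 2) a := by
    intro a
    have ha := qPochhammer_ne_zero hq a
    have ham := qPochhammer_ne_zero hq (a + 1 + m)
    have hsub := one_sub_pow_ne_zero hq a.succ_ne_zero
    simp only [durfeeTerm, show a + (m + 1) = a + 1 + m by ring, qPochhammer_succ q a]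
    field_simp
    ring
  have hzero : durfeeTerm q m (s + 1) 0 = durfeeTerm q m s 0 := by simp [durfeeTerm]
  simp only [durfeeSum]
  rw [(summable_durfeeTerm hq m (s + 1)).tsum_eq_zero_add,
    (summable_durfeeTerm hq m s).tsum_eq_zero_add, hzero, ← tsum_mul_left, add_sub_assoc,
    ← Summable.tsum_sub ((summable_nat_add_iff 1).mpr (summable_durfeeTerm hq m s))
      ((summable_durfeeTerm hq _ _).mul_left _)]
  simp only [hterm]

lemma durfeeSum_succ_left (hq : ‖q‖ < 1) (m s : ℕ) :
    q ^ (m + 1) * durfeeSum q (m + 1) (s + 1) = durfeeSum q (m + 1) s - durfeeSum q m s := by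
  simp only [durfeeSum]
  rw [← tsum_mul_left,
    ← Summable.tsum_sub (summable_durfeeTerm hq _ _) (summable_durfeeTerm hq _ _)]
  refine tsum_congr fun a => ?_
  have ha := qPochhammer_ne_zero hq a
  have ham := qPochhammer_ne_zero hq (a + m)
  have hsub := one_sub_pow_ne_zero hq (a + m).succ_ne_zero
  simp only [durfeeTerm, ← add_assoc, qPochhammer_succ q (a + m)]
  field_simp
  ring

lemma durfeeSum_self_eq_zero_zero (hq : ‖q‖ < 1) (m : ℕ) :
    durfeeSum q m m = durfeeSum q 0 0 := by
  induction m with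
  | zero => rfl
  | succ m ih =>
    rw [← ih]
    linear_combination durfeeSum_succ_right hq m m - durfeeSum_succ_left hq m (m + 1)

lemma tendsto_durfeeSum_self (hq : ‖q‖ < 1) :
    Tendsto (fun m => durfeeSum q m m) atTop (𝓝 (qPochhammerInf q)⁻¹) := by
  obtain ⟨C, hC, h⟩ := exists_norm_inv_qPochhammer_le hq
  have hterm : ∀ a, Tendsto (fun m => durfeeTerm q m m a) atTop
      (𝓝 (if a = 0 then (qPochhammerInf q)⁻¹ else 0)) := by
    intro a
    rcases Nat.eq_zero_or_pos a with rfl | ha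
    · simpa [durfeeTerm] using tendsto_inv_qPochhammer hq
    · rw [if_neg ha.ne']
      refine squeeze_zero_norm (a := fun m => ‖q‖ ^ m * (C * C))
        (fun m => norm_durfeeTerm_le hq hC h (by nlinarith)) ?_
      simpa using (tendsto_pow_atTop_nhds_zero_of_lt_one (norm_nonneg _) hq).mul_const (C * C)
  have hlim := tendsto_tsum_of_dominated_convergence
    ((summable_geometric_of_lt_one (norm_nonneg _) hq).mul_right (C * C)) hterm
    (Eventually.of_forall fun m a => norm_durfeeTerm_le hq hC h (le_mul_self_add_mul a m))
  rwa [tsum_ite_eq] at hlim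

lemma durfeeSum_self (hq : ‖q‖ < 1) (m : ℕ) : durfeeSum q m m = (qPochhammerInf q)⁻¹ := by
  refine tendsto_nhds_unique (tendsto_const_nhds (f := atTop (α := ℕ))) ?_
  refine (tendsto_durfeeSum_self hq).congr fun n => ?_
  rw [durfeeSum_self_eq_zero_zero hq n, durfeeSum_self_eq_zero_zero hq m]

lemma summable_partialTheta (hq : ‖q‖ < 1) (m : ℕ) :
    Summable fun n : ℕ => (-1) ^ n * q ^ (n * (n + 1) / 2 + n * m) :=
  Summable.of_norm_bounded (summable_geometric_of_lt_one (norm_nonneg _) hq)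
    fun n => norm_neg_one_pow_mul_pow_le hq (n * m) n

lemma partialTheta_eq_one_sub (hq : ‖q‖ < 1) (m : ℕ) :
    partialTheta q m = 1 - q ^ (m + 1) * partialTheta q (m + 1) := by
  rw [partialTheta, (summable_partialTheta hq m).tsum_eq_zero_add, partialTheta, ← tsum_mul_left,
    sub_eq_add_neg, ← tsum_neg]
  congr 1
  · simp
  · refine tsum_congr fun n => ?_
    rw [succ_mul_add_two_div_two]
    ring

lemma hasSum_partialTheta_sub (hq : ‖q‖ < 1) (m : ℕ) :
    HasSum (fun n : ℕ => (-1) ^ n * q ^ (n * (n + 1) / 2 + n * m) * (1 - q ^ (n + 1)))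
      (partialTheta q m - q * partialTheta q (m + 1)) := by
  refine ((summable_partialTheta hq m).hasSum.sub
    ((summable_partialTheta hq (m + 1)).hasSum.mul_left q)).congr_fun fun n => ?_
  ring

lemma durfeeSum_self_succ (hq : ‖q‖ < 1) (m : ℕ) :
    durfeeSum q m (m + 1) * qPochhammerInf q = partialTheta q m := by
  obtain ⟨C, hC⟩ := exists_norm_durfeeSum_le hq
  refine sub_eq_zero.mp (eq_zero_of_eq_mul_succ hq (c := fun m => -q ^ (m + 1))
    (D := fun m => durfeeSum q m (m + 1) * qPochhammerInf q - partialTheta q m)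
    (B := C * ‖qPochhammerInf q‖ + (1 - ‖q‖)⁻¹) (fun m => ?_) (fun m => ?_) (fun m => ?_) m)
  · simpa using norm_pow_le_norm_pow hq (Nat.le_add_left 1 m)
  · refine (norm_sub_le _ _).trans (add_le_add ?_ (norm_partialTheta_le hq m))
    rw [norm_mul]
    exact mul_le_mul_of_nonneg_right (hC _ _) (norm_nonneg _)
  · have hdurfee := durfeeSum_succ_right hq m m
    rw [durfeeSum_self hq] at hdurfee
    linear_combination qPochhammerInf q * hdurfee - partialTheta_eq_one_sub hq m
      + inv_mul_cancel₀ (qPochhammerInf_ne_zero hq)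

lemma one_sub_mul_durfeeSum_mul (hq : ‖q‖ < 1) (m : ℕ) :
    (1 - q) * durfeeSum q m (m + 2) * qPochhammerInf q =
      partialTheta q m - q * partialTheta q (m + 1) := by
  rw [← durfeeSum_self_succ hq, ← durfeeSum_self_succ hq]
  linear_combination qPochhammerInf q *
    (durfeeSum_succ_right hq m (m + 1) - q * durfeeSum_succ_left hq m (m + 2))

end NormedField

section GeneratingFunctions

open Pointwise

/-- The multisets all of whose members lie in `T`. -/
def partsIn (T : Set ℕ) : Set (Multiset ℕ) := {s | ∀ i ∈ s, i ∈ T}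

lemma partsIn_mono {T U : Set ℕ} (h : T ⊆ U) : partsIn T ⊆ partsIn U :=
  fun _ hs i hi => h (hs i hi)

lemma partsIn_empty : partsIn ∅ = {0} := by
  ext s
  simp [partsIn, Multiset.eq_zero_iff_forall_notMem]

lemma partsIn_singleton (i : ℕ) :
    partsIn {i} = Set.range fun c => Multiset.replicate c i := by
  ext s
  refine ⟨fun h => ⟨s.card, (Multiset.eq_replicate.mpr ⟨rfl, h⟩).symm⟩, ?_⟩
  rintro ⟨c, rfl⟩ j hj
  exact Multiset.eq_of_mem_replicate hj

lemma partsIn_union (T U : Set ℕ) : partsIn (T ∪ U) = partsIn T + partsIn U := by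
  classical
  ext s
  rw [Set.mem_add]
  constructor
  · refine fun hs => ⟨s.filter (· ∈ T), fun i hi => (Multiset.mem_filter.mp hi).2,
      s.filter (· ∉ T), fun i hi => ?_, Multiset.filter_add_not _ _⟩
    obtain ⟨his, hiT⟩ := Multiset.mem_filter.mp hi
    exact (hs i his).resolve_left hiT
  · rintro ⟨t, ht, u, hu, rfl⟩ i hi
    exact (Multiset.mem_add.mp hi).imp (ht i) (hu i)

lemma filter_add_of_mem_partsIn {T U : Set ℕ} [DecidablePred (· ∈ T)] (h : Disjoint T U)
    {t u : Multiset ℕ} (ht : t ∈ partsIn T) (hu : u ∈ partsIn U) :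
    (t + u).filter (· ∈ T) = t := by
  rw [Multiset.filter_add, Multiset.filter_eq_self.mpr ht, Multiset.filter_eq_nil.mpr, add_zero]
  exact fun i hi hiT => Set.disjoint_left.mp h hiT (hu i hi)

/-- The multisets of `b` natural numbers, all at least `k`. -/
def largeParts (k b : ℕ) : Set (Multiset ℕ) := {s ∈ partsIn (Set.Ici k) | s.card = b}

lemma largeParts_subset (k b : ℕ) : largeParts k b ⊆ partsIn (Set.Ici k) :=
  Set.sep_subset _ _

lemma largeParts_zero (k : ℕ) : largeParts k 0 = {0} := by
  ext s
  simp +contextual [largeParts, partsIn]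

lemma largeParts_succ_left (k b : ℕ) :
    largeParts (k + 1) b = Multiset.map Nat.succ '' largeParts k b := by
  ext s
  constructor
  · rintro ⟨hs, hcard⟩
    refine ⟨s.map Nat.pred, ⟨fun i hi => ?_, by simpa using hcard⟩, ?_⟩
    · obtain ⟨j, hj, rfl⟩ := Multiset.mem_map.mp hi
      exact Nat.le_pred_of_lt (hs j hj)
    · rw [Multiset.map_map]
      refine (Multiset.map_congr rfl fun i hi => ?_).trans (Multiset.map_id s)
      exact Nat.succ_pred_eq_of_pos (k.succ_pos.trans_le (hs i hi))
  · rintro ⟨t, ⟨ht, hcard⟩, rfl⟩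
    refine ⟨fun i hi => ?_, by simpa using hcard⟩
    obtain ⟨j, hj, rfl⟩ := Multiset.mem_map.mp hi
    exact Nat.succ_le_succ (ht j hj)

lemma largeParts_succ_right (k b : ℕ) :
    largeParts k (b + 1) = Multiset.cons k '' largeParts k b ∪ largeParts (k + 1) (b + 1) := by
  ext s
  constructor
  · rintro ⟨hs, hcard⟩
    by_cases hk : k ∈ s
    · obtain ⟨t, rfl⟩ := Multiset.exists_cons_of_mem hk
      exact Or.inl ⟨t, ⟨fun i hi => hs i (Multiset.mem_cons_of_mem hi), by simpa using hcard⟩, rfl⟩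
    · exact Or.inr ⟨fun i hi => lt_of_le_of_ne (hs i hi) (ne_of_mem_of_not_mem hi hk).symm, hcard⟩
  · rintro (⟨t, ⟨ht, hcard⟩, rfl⟩ | ⟨hs, hcard⟩)
    · refine ⟨fun i hi => ?_, by simpa using hcard⟩
      rcases Multiset.mem_cons.mp hi with rfl | hi
      exacts [Set.self_mem_Ici, ht i hi]
    · exact ⟨fun i hi => (Nat.le_succ k).trans (hs i hi), hcard⟩

lemma disjoint_cons_image_largeParts_succ (k b b' : ℕ) :
    Disjoint (Multiset.cons k '' largeParts k b) (largeParts (k + 1) b') := by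
  rw [Set.disjoint_left]
  rintro _ ⟨t, -, rfl⟩ ⟨ht, -⟩
  exact (ht k (Multiset.mem_cons_self k t)).not_gt k.lt_succ_self

variable {K : Type*} [NormedField K] {q : K}

/-- `HasGenFun q S a` means that the generating function `∑_{s ∈ S} q ^ s.sum` of the set `S` of
multisets converges absolutely, with value `a`. -/
structure HasGenFun (q : K) (S : Set (Multiset ℕ)) (a : K) : Prop where
  summable_norm : Summable fun s : S => ‖q ^ s.1.sum‖
  hasSum : HasSum (fun s : S => q ^ s.1.sum) a

lemma hasGenFun_range {ι : Type*} {g : ι → Multiset ℕ} {a : K} (hg : g.Injective)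
    (hnorm : Summable fun i => ‖q ^ (g i).sum‖) (ha : HasSum (fun i => q ^ (g i).sum) a) :
    HasGenFun q (Set.range g) a :=
  ⟨(Equiv.ofInjective g hg).summable_iff.mp hnorm, (Equiv.ofInjective g hg).hasSum_iff.mp ha⟩

lemma hasGenFun_singleton (q : K) (s : Multiset ℕ) : HasGenFun q {s} (q ^ s.sum) := by
  rw [← Set.range_const (ι := Unit)]
  exact hasGenFun_range (Function.injective_of_subsingleton _) (hasSum_fintype _).summable
    (hasSum_unique _)

namespace HasGenFun

variable {S S' : Set (Multiset ℕ)} {a b : K}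

lemma image (h : HasGenFun q S a) {g : Multiset ℕ → Multiset ℕ} (hg : g.Injective) {c : ℕ}
    (hsum : ∀ s ∈ S, (g s).sum = c + s.sum) : HasGenFun q (g '' S) (q ^ c * a) := by
  have hterm : ∀ s : S, q ^ (g s).sum = q ^ c * q ^ s.1.sum := fun s => by
    rw [hsum s s.2, pow_add]
  rw [Set.image_eq_range]
  refine hasGenFun_range (hg.comp Subtype.val_injective) ?_ ?_
  · simp only [hterm, norm_mul]
    exact h.summable_norm.mul_left _
  · simp only [hterm]
    exact h.hasSum.mul_left _

lemma union (h : HasGenFun q S a) (h' : HasGenFun q S' b) (hdisj : Disjoint S S') :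
    HasGenFun q (S ∪ S') (a + b) :=
  ⟨(h.summable_norm.hasSum.add_disjoint (f := fun s : Multiset ℕ => ‖q ^ s.sum‖) hdisj
      h'.summable_norm.hasSum).summable,
    h.hasSum.add_disjoint (f := fun s : Multiset ℕ => q ^ s.sum) hdisj h'.hasSum⟩

lemma add [CompleteSpace K] (h : HasGenFun q S a) (h' : HasGenFun q S' b) {T T' : Set ℕ}
    (hS : S ⊆ partsIn T) (hS' : S' ⊆ partsIn T') (hdisj : Disjoint T T') :
    HasGenFun q (S + S') (a * b) := by
  classical
  have hterm : ∀ x : S × S', q ^ (x.1.1 + x.2.1).sum = q ^ x.1.1.sum * q ^ x.2.1.sum :=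
    fun x => by rw [Multiset.sum_add, pow_add]
  have hinj : Function.Injective fun x : S × S' => x.1.1 + x.2.1 := by
    rintro ⟨⟨s, hs⟩, ⟨s', hs'⟩⟩ ⟨⟨t, ht⟩, ⟨t', ht'⟩⟩ (hst : s + s' = t + t')
    obtain rfl : s = t := by
      rw [← filter_add_of_mem_partsIn hdisj (hS hs) (hS' hs'), hst,
        filter_add_of_mem_partsIn hdisj (hS ht) (hS' ht')]
    obtain rfl := add_left_cancel hst
    rfl
  have hnorm := Summable.mul_norm (f := fun s : S => q ^ s.1.sum)
    (g := fun s : S' => q ^ s.1.sum) h.summable_norm h'.summable_norm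
  have hrange : S + S' = Set.range fun x : S × S' => x.1.1 + x.2.1 := by
    ext s
    simp [Set.mem_add]
  rw [hrange]
  refine hasGenFun_range hinj ?_ ?_
  · simp only [hterm]
    exact hnorm
  · simp only [hterm]
    exact HasSum.mul (f := fun s : S => q ^ s.1.sum) (g := fun s : S' => q ^ s.1.sum)
      h.hasSum h'.hasSum hnorm.of_norm

lemma largeParts_succ_left {k b : ℕ} {a : K} (h : HasGenFun q (largeParts k b) a) :
    HasGenFun q (largeParts (k + 1) b) (q ^ b * a) := by
  rw [_root_.largeParts_succ_left]
  refine h.image (Multiset.map_injective Nat.succ_injective) fun s hs => ?_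
  rw [← hs.2]
  simp [Nat.succ_eq_add_one, Multiset.sum_map_add, add_comm]

end HasGenFun

lemma hasGenFun_partsIn_singleton (hq : ‖q‖ < 1) {i : ℕ} (hi : i ≠ 0) :
    HasGenFun q (partsIn {i}) (1 - q ^ i)⁻¹ := by
  have hterm : ∀ c, q ^ (Multiset.replicate c i).sum = (q ^ i) ^ c := fun c => by
    rw [Multiset.sum_replicate, smul_eq_mul, mul_comm, pow_mul]
  have hlt := norm_pow_lt_one hq hi
  rw [partsIn_singleton]
  refine hasGenFun_range (Multiset.replicate_left_injective i) ?_ ?_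
  · simp only [hterm, norm_pow _ (_ : ℕ)]
    simpa only [norm_pow] using summable_geometric_of_lt_one (norm_nonneg _) hlt
  · simp only [hterm]
    exact hasSum_geometric_of_norm_lt_one hlt

lemma hasGenFun_partsIn_finset [CompleteSpace K] (hq : ‖q‖ < 1) {T : Finset ℕ} (h0 : 0 ∉ T) :
    HasGenFun q (partsIn T) (∏ i ∈ T, (1 - q ^ i)⁻¹) := by
  induction T using Finset.cons_induction with
  | empty => simpa [partsIn_empty] using hasGenFun_singleton q 0
  | cons i T hi ih =>
    obtain ⟨hi0, hT0⟩ : i ≠ 0 ∧ 0 ∉ T := by simpa [eq_comm] using h0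
    rw [Finset.prod_cons, Finset.coe_cons, ← Set.singleton_union, partsIn_union]
    exact (hasGenFun_partsIn_singleton hq hi0).add (ih hT0) subset_rfl subset_rfl (by simpa)

lemma hasGenFun_partsIn_Icc_one [CompleteSpace K] (hq : ‖q‖ < 1) (n : ℕ) :
    HasGenFun q (partsIn (Set.Icc 1 n)) (qPochhammer q n)⁻¹ := by
  have h := hasGenFun_partsIn_finset hq (T := Finset.Icc 1 n) (by simp)
  rwa [Finset.coe_Icc, Finset.prod_inv_distrib, ← Finset.Ico_add_one_right_eq_Icc,
    Finset.prod_Ico_eq_prod_range, Nat.add_sub_cancel,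
    Finset.prod_congr rfl fun i _ => by rw [add_comm 1 i]] at h

lemma hasGenFun_partsIn_Icc_two [CompleteSpace K] (hq : ‖q‖ < 1) {n : ℕ} (hn : n ≠ 0) :
    HasGenFun q (partsIn (Set.Icc 2 n)) ((1 - q) * (qPochhammer q n)⁻¹) := by
  have h := hasGenFun_partsIn_finset hq (T := Finset.Icc 2 n) (by simp)
  obtain ⟨m, rfl⟩ := Nat.exists_eq_succ_of_ne_zero hn
  have hprod : (1 - q) * (qPochhammer q (m + 1))⁻¹ = ∏ i ∈ Finset.Icc 2 (m + 1), (1 - q ^ i)⁻¹ := by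
    have hsub := one_sub_pow_ne_zero hq one_ne_zero
    rw [pow_one] at hsub
    rw [Finset.prod_inv_distrib, ← Finset.Ico_add_one_right_eq_Icc, Finset.prod_Ico_eq_prod_range,
      qPochhammer, Finset.prod_range_succ', mul_inv, mul_comm]
    simp [add_comm, add_left_comm, hsub]
  rwa [Finset.coe_Icc, ← hprod] at h

lemma summable_norm_pow_sum (hq : ‖q‖ < 1) {S : Set (Multiset ℕ)} (hS : S ⊆ partsIn (Set.Ici 1)) :
    Summable fun s : S => ‖q ^ s.1.sum‖ := by
  have hr : ‖‖q‖‖ < 1 := by rwa [norm_norm]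
  obtain ⟨C, -, hC⟩ := exists_norm_inv_qPochhammer_le hr
  refine summable_of_sum_le (c := C) (fun _ => norm_nonneg _) fun u => ?_
  obtain ⟨N, hN⟩ : ∃ N, ∀ s ∈ u, s.1 ∈ partsIn (Set.Icc 1 N) := by
    refine ⟨u.sup fun s => s.1.sup, fun s hs i hi => ⟨hS s.2 i hi, ?_⟩⟩
    exact (Multiset.le_sup hi).trans (Finset.le_sup (f := fun s : S => s.1.sup) hs)
  have hgf := (hasSum_subtype_iff_indicator (f := fun s : Multiset ℕ => ‖q‖ ^ s.sum)).mp
    (hasGenFun_partsIn_Icc_one hr N).hasSum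
  calc ∑ s ∈ u, ‖q ^ s.1.sum‖
      = ∑ s ∈ u.map (Function.Embedding.subtype _),
          (partsIn (Set.Icc 1 N)).indicator (fun s : Multiset ℕ => ‖q‖ ^ s.sum) s := by
        rw [Finset.sum_map]
        refine Finset.sum_congr rfl fun s hs => ?_
        rw [Function.Embedding.subtype_apply, Set.indicator_of_mem (hN s hs), norm_pow]
    _ ≤ (qPochhammer ‖q‖ N)⁻¹ :=
        sum_le_hasSum _ (fun s _ => Set.indicator_nonneg (fun _ _ => by positivity) s) hgf
    _ ≤ C := (le_abs_self _).trans (hC N)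

/-- A partition of any natural number amounts to its multiset of parts. -/
def sigmaPartitionEquiv (S : Set (Multiset ℕ)) (hS : S ⊆ partsIn (Set.Ici 1)) :
    (Σ n : ℕ, {p : n.Partition // p.parts ∈ S}) ≃ S where
  toFun p := ⟨p.2.1.parts, p.2.2⟩
  invFun s := ⟨s.1.sum, ⟨s.1, fun h => hS s.2 _ h, rfl⟩, s.2⟩
  left_inv := by
    rintro ⟨_, ⟨s, h, rfl⟩, hs⟩
    rfl
  right_inv _ := rfl

lemma HasGenFun.hasSum_card_partition {S : Set (Multiset ℕ)} {a : K} (h : HasGenFun q S a)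
    (hS : S ⊆ partsIn (Set.Ici 1)) :
    HasSum (fun n : ℕ => (Nat.card {p : n.Partition // p.parts ∈ S} : K) * q ^ n) a := by
  refine ((sigmaPartitionEquiv S hS).hasSum_iff.mpr h.hasSum).sigma fun n => ?_
  classical
  have hterm : ∀ p : {p : n.Partition // p.parts ∈ S}, q ^ p.1.parts.sum = q ^ n := fun p => by
    rw [p.1.parts_sum]
  convert! hasSum_fintype fun p : {p : n.Partition // p.parts ∈ S} => q ^ p.1.parts.sum using 1
  simp only [hterm, Finset.sum_const, Finset.card_univ, Nat.card_eq_fintype_card, nsmul_eq_mul]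

variable [CompleteSpace K]

lemma HasGenFun.iUnion (hq : ‖q‖ < 1) {ι : Type*} {S : ι → Set (Multiset ℕ)} {g : ι → K} {a : K}
    (hpos : ∀ i, S i ⊆ partsIn (Set.Ici 1)) (hdisj : Pairwise (Function.onFun Disjoint S))
    (h : ∀ i, HasGenFun q (S i) (g i)) (hg : HasSum g a) : HasGenFun q (⋃ i, S i) a := by
  have hnorm := summable_norm_pow_sum hq (Set.iUnion_subset hpos)
  refine ⟨hnorm, (Equiv.hasSum_iff (Set.unionEqSigmaOfDisjoint hdisj).symm).mp ?_⟩
  exact HasSum.sigma_of_hasSum hg (fun i => (h i).hasSum)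
    ((Equiv.summable_iff (Set.unionEqSigmaOfDisjoint hdisj).symm).mpr hnorm.of_norm)

lemma hasGenFun_largeParts (hq : ‖q‖ < 1) {k : ℕ} (hk : k ≠ 0) (b : ℕ) :
    HasGenFun q (largeParts k b) (q ^ (k * b) * (qPochhammer q b)⁻¹) := by
  induction b with
  | zero => simpa [largeParts_zero] using hasGenFun_singleton q 0
  | succ b ih =>
    have hnorm := summable_norm_pow_sum hq ((largeParts_subset k (b + 1)).trans
      (partsIn_mono (Set.Ici_subset_Ici.mpr (Nat.one_le_iff_ne_zero.mpr hk))))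
    obtain ⟨a, ha⟩ := hnorm.of_norm
    have hself : HasGenFun q (largeParts k (b + 1)) a := ⟨hnorm, ha⟩
    have hcons := ih.image (g := Multiset.cons k) (c := k)
      (fun s t => (Multiset.cons_inj_right k).mp) fun s _ => Multiset.sum_cons k s
    have hsplit := hcons.union hself.largeParts_succ_left
      (disjoint_cons_image_largeParts_succ k b (b + 1))
    rw [← largeParts_succ_right] at hsplit
    have hrec := ha.unique hsplit.hasSum
    have hsub := one_sub_pow_ne_zero hq b.succ_ne_zero
    have hb := qPochhammer_ne_zero hq b
    convert! hself using 1
    rw [qPochhammer_succ]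
    field_simp at hrec ⊢
    linear_combination -hrec

end GeneratingFunctions

section CrankGeneratingFunction

open Pointwise

/-- A pair of natural numbers attached to a multiset, with difference the crank: the first entry is
the multiplicity `a` of `1`, the second one is the number of members larger than `a` if `a > 0`, and
the largest member if `a = 0`. -/
def crankPair (s : Multiset ℕ) : ℕ × ℕ :=
  (s.count 1, if 1 ∈ s then s.countP (s.count 1 < ·) else s.sup)

lemma crank_eq_crankPair {n : ℕ} (p : n.Partition) :
    crank p = (crankPair p.parts).2 - (crankPair p.parts).1 := by
  unfold crank crankPair
  split_ifs with h
  · rfl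
  · simp [Multiset.count_eq_zero.mpr h]

/-- The multisets of positive integers with given `crankPair`. -/
def crankFiber (x : ℕ × ℕ) : Set (Multiset ℕ) := {s ∈ partsIn (Set.Ici 1) | crankPair s = x}

lemma crankFiber_subset (x : ℕ × ℕ) : crankFiber x ⊆ partsIn (Set.Ici 1) :=
  Set.sep_subset _ _

lemma disjoint_crankFiber {x y : ℕ × ℕ} (h : x ≠ y) : Disjoint (crankFiber x) (crankFiber y) :=
  Set.disjoint_left.mpr fun _ hx hy => h (hx.2.symm.trans hy.2)

lemma mem_crankFiber_zero_left {s : Multiset ℕ} {b : ℕ} :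
    s ∈ crankFiber (0, b) ↔ s ∈ partsIn (Set.Ici 2) ∧ s.sup = b := by
  constructor
  · rintro ⟨hs, hpair⟩
    obtain ⟨hcount, hsup⟩ := Prod.mk.inj hpair
    have h1 : 1 ∉ s := Multiset.count_eq_zero.mp hcount
    rw [if_neg h1] at hsup
    exact ⟨fun i hi => lt_of_le_of_ne (hs i hi) (ne_of_mem_of_not_mem hi h1).symm, hsup⟩
  · rintro ⟨hs, hsup⟩
    have h1 : 1 ∉ s := fun h => absurd (hs 1 h) (by simp)
    refine ⟨partsIn_mono (Set.Ici_subset_Ici.mpr one_le_two) hs, ?_⟩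
    rw [crankPair, Multiset.count_eq_zero.mpr h1, if_neg h1, hsup]

lemma crankFiber_zero_zero : crankFiber (0, 0) = {0} := by
  ext s
  rw [mem_crankFiber_zero_left, Set.mem_singleton_iff]
  refine ⟨fun ⟨hs, hsup⟩ => Multiset.eq_zero_of_forall_notMem fun i hi => ?_, ?_⟩
  · have h2 : 2 ≤ i := hs i hi
    have hle : i ≤ 0 := hsup ▸ Multiset.le_sup hi
    omega
  · rintro rfl
    exact ⟨fun i hi => absurd hi (Multiset.notMem_zero i), Multiset.sup_zero⟩

lemma crankFiber_zero_one : crankFiber (0, 1) = ∅ := by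
  refine Set.eq_empty_of_forall_notMem fun s hs => ?_
  obtain ⟨hs2, hsup⟩ := mem_crankFiber_zero_left.mp hs
  have hzero : s.sup ≤ 0 := Multiset.sup_le.mpr fun i hi => by
    have h2 : 2 ≤ i := hs2 i hi
    have hle := Multiset.le_sup hi
    omega
  omega

lemma crankFiber_zero_left {b : ℕ} (hb : 2 ≤ b) :
    crankFiber (0, b) = Multiset.cons b '' partsIn (Set.Icc 2 b) := by
  ext s
  rw [mem_crankFiber_zero_left]
  constructor
  · rintro ⟨hs, hsup⟩
    have hmem : b ∈ s := by
      by_contra hbs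
      have hle : s.sup ≤ b - 1 := Multiset.sup_le.mpr fun i hi =>
        Nat.le_sub_one_of_lt (lt_of_le_of_ne (hsup ▸ Multiset.le_sup hi)
          (ne_of_mem_of_not_mem hi hbs))
      omega
    obtain ⟨t, rfl⟩ := Multiset.exists_cons_of_mem hmem
    exact ⟨t, fun i hi => ⟨hs i (Multiset.mem_cons_of_mem hi),
      hsup ▸ Multiset.le_sup (Multiset.mem_cons_of_mem hi)⟩, rfl⟩
  · rintro ⟨t, ht, rfl⟩
    constructor
    · intro i hi
      rcases Multiset.mem_cons.mp hi with rfl | hi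
      exacts [hb, (ht i hi).1]
    · rw [Multiset.sup_cons, sup_eq_left]
      exact Multiset.sup_le.mpr fun i hi => (ht i hi).2

lemma count_one_replicate_add (c : ℕ) {s : Multiset ℕ} (hs : s ∈ partsIn (Set.Ici 2)) :
    (Multiset.replicate c 1 + s).count 1 = c := by
  have h1 : 1 ∉ s := fun h => absurd (hs 1 h) (by simp)
  rw [Multiset.count_add, Multiset.count_replicate_self, Multiset.count_eq_zero.mpr h1, add_zero]

lemma add_mem_partsIn_Ici_two {a : ℕ} (ha : a ≠ 0) {t l : Multiset ℕ}
    (ht : t ∈ partsIn (Set.Icc 2 a)) (hl : l ∈ partsIn (Set.Ici (a + 1))) :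
    t + l ∈ partsIn (Set.Ici 2) := fun i hi =>
  (Multiset.mem_add.mp hi).elim (fun h => (ht i h).1) fun h =>
    (show 2 ≤ a + 1 by omega).trans (hl i h)

lemma crankPair_replicate_add {a : ℕ} (ha : a ≠ 0) {t l : Multiset ℕ}
    (ht : t ∈ partsIn (Set.Icc 2 a)) (hl : l ∈ partsIn (Set.Ici (a + 1))) :
    crankPair (Multiset.replicate a 1 + (t + l)) = (a, l.card) := by
  have hcount := count_one_replicate_add a (add_mem_partsIn_Ici_two ha ht hl)
  have hmem : 1 ∈ Multiset.replicate a 1 + (t + l) := by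
    rwa [← Multiset.count_pos, hcount, Nat.pos_iff_ne_zero]
  rw [crankPair, hcount, if_pos hmem, Multiset.countP_add, Multiset.countP_add,
    Multiset.countP_eq_zero.mpr, Multiset.countP_eq_zero.mpr, Multiset.countP_eq_card.mpr,
    zero_add, zero_add]
  · exact hl
  · exact fun i hi => not_lt.mpr (ht i hi).2
  · intro i hi
    rw [Multiset.eq_of_mem_replicate hi]
    omega

lemma crankFiber_of_ne_zero {a : ℕ} (ha : a ≠ 0) (b : ℕ) :
    crankFiber (a, b) =
      {Multiset.replicate a 1} + (partsIn (Set.Icc 2 a) + largeParts (a + 1) b) := by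
  have hcover : Set.Ici 1 = {1} ∪ (Set.Icc 2 a ∪ Set.Ici (a + 1)) := by
    ext i
    simp only [Set.mem_Ici, Set.mem_union, Set.mem_singleton_iff, Set.mem_Icc]
    omega
  ext s
  simp only [crankFiber, hcover, partsIn_union, Set.mem_ofPred_eq, Set.mem_add,
    partsIn_singleton, Set.mem_singleton_iff]
  constructor
  · rintro ⟨⟨_, ⟨c, rfl⟩, _, ⟨t, ht, l, hl, rfl⟩, rfl⟩, hpair⟩
    obtain rfl : c = a := by
      rw [← count_one_replicate_add c (add_mem_partsIn_Ici_two ha ht hl)]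
      exact congrArg Prod.fst hpair
    rw [crankPair_replicate_add ha ht hl] at hpair
    exact ⟨_, rfl, _, ⟨t, ht, l, ⟨hl, congrArg Prod.snd hpair⟩, rfl⟩, rfl⟩
  · rintro ⟨_, rfl, _, ⟨t, ht, l, ⟨hl, rfl⟩, rfl⟩, rfl⟩
    exact ⟨⟨_, ⟨a, rfl⟩, _, ⟨t, ht, l, hl, rfl⟩, rfl⟩, crankPair_replicate_add ha ht hl⟩

variable {K : Type*} [NormedField K] {q : K}

/-- The generating function `(1 - q) q ^ (a b + a + b) / ((q)_a (q)_b)` of the partitions with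
`crankPair` equal to `(a, b)`, valid unless `a = 0` and `b ≤ 1`. -/
def crankKernel (q : K) (x : ℕ × ℕ) : K :=
  (1 - q) * q ^ (x.1 * x.2 + x.1 + x.2) * ((qPochhammer q x.1)⁻¹ * (qPochhammer q x.2)⁻¹)

/-- The number of partitions of `1` with crank `m`, minus the conventional value `M(m, 1)`. -/
def crankExcess (m : ℤ) : ℤ := if m = 0 then 1 else if m = 1 then -1 else 0

section Complete

variable [CompleteSpace K]

lemma hasGenFun_crankFiber_of_ne_zero (hq : ‖q‖ < 1) {a : ℕ} (ha : a ≠ 0) (b : ℕ) :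
    HasGenFun q (crankFiber (a, b)) (crankKernel q (a, b)) := by
  have hlarge := hasGenFun_largeParts hq (k := a + 1) a.succ_ne_zero b
  have hmiddle := (hasGenFun_partsIn_Icc_two hq ha).add hlarge subset_rfl (largeParts_subset _ _)
    (Set.disjoint_left.mpr fun i hi hi' => hi.2.not_gt hi')
  have hones : {Multiset.replicate a 1} ⊆ partsIn {1} := by
    rw [partsIn_singleton]
    exact Set.singleton_subset_iff.mpr ⟨a, rfl⟩
  have hgf := (hasGenFun_singleton q (Multiset.replicate a 1)).add hmiddle hones
    (T' := Set.Ici 2) (by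
      rintro _ ⟨t, ht, l, hl, rfl⟩
      exact add_mem_partsIn_Ici_two ha ht (largeParts_subset _ _ hl)) (by simp)
  rw [crankFiber_of_ne_zero ha]
  convert! hgf using 1
  simp only [crankKernel, Multiset.sum_replicate, smul_eq_mul]
  ring

lemma hasGenFun_crankFiber_zero_left (hq : ‖q‖ < 1) (b : ℕ) :
    HasGenFun q (crankFiber (0, b)) (crankKernel q (0, b) + q * crankExcess b) := by
  match b with
  | 0 =>
    rw [crankFiber_zero_zero]
    convert! hasGenFun_singleton q 0 using 1
    simp [crankKernel, crankExcess]
  | 1 =>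
    have hsub := one_sub_pow_ne_zero hq one_ne_zero
    rw [crankFiber_zero_one]
    convert! (⟨(hasSum_empty).summable, hasSum_empty⟩ : HasGenFun q ∅ 0) using 1
    rw [pow_one] at hsub
    simp [crankKernel, crankExcess, qPochhammer, mul_right_comm _ q, hsub]
  | b + 2 =>
    have hgf := (hasGenFun_partsIn_Icc_two hq (b + 1).succ_ne_zero).image
      (g := Multiset.cons (b + 2)) (fun s t => (Multiset.cons_inj_right _).mp)
      fun s _ => Multiset.sum_cons (b + 2) s
    rw [crankFiber_zero_left (Nat.le_add_left 2 b)]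
    convert! hgf using 1
    have h0 : ((b + 2 : ℕ) : ℤ) ≠ 0 := by omega
    have h1 : ((b + 2 : ℕ) : ℤ) ≠ 1 := by omega
    simp only [crankKernel, crankExcess, if_neg h0, if_neg h1, qPochhammer_zero, zero_mul,
      zero_add, inv_one, Int.cast_zero, mul_zero, add_zero, one_mul]
    ring

lemma hasGenFun_crankFiber (hq : ‖q‖ < 1) (x : ℕ × ℕ) :
    HasGenFun q (crankFiber x)
      (crankKernel q x + q * if x.1 = 0 then (crankExcess x.2 : K) else 0) := by
  obtain ⟨a, b⟩ := x
  rcases eq_or_ne a 0 with rfl | ha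
  · simpa using hasGenFun_crankFiber_zero_left hq b
  · simpa [ha] using hasGenFun_crankFiber_of_ne_zero hq ha b

end Complete

/-- The pairs of natural numbers with difference `m`, indexed by their minimum. -/
def diagonalPair (m : ℤ) (c : ℕ) : ℕ × ℕ := (c + (-m).toNat, c + m.toNat)

lemma diagonalPair_injective (m : ℤ) : (diagonalPair m).Injective := fun c d h => by
  simpa [diagonalPair] using h

lemma exists_diagonalPair_eq_iff {m : ℤ} {x : ℕ × ℕ} :
    (∃ c, diagonalPair m c = x) ↔ (x.2 : ℤ) - x.1 = m := by
  constructor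
  · rintro ⟨c, rfl⟩
    simp only [diagonalPair]
    omega
  · rintro rfl
    refine ⟨min x.1 x.2, Prod.ext ?_ ?_⟩ <;> simp only [diagonalPair] <;> omega

lemma crankKernel_diagonalPair (q : K) (m : ℤ) (c : ℕ) :
    crankKernel q (diagonalPair m c) =
      q ^ m.natAbs * ((1 - q) * durfeeTerm q m.natAbs (m.natAbs + 2) c) := by
  rcases m.eq_nat_or_neg with ⟨n, rfl | rfl⟩ <;>
  · simp only [crankKernel, diagonalPair, durfeeTerm, neg_neg, Int.toNat_natCast,
      Int.toNat_neg_natCast, Int.natAbs_neg, Int.natAbs_natCast, add_zero]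
    ring

lemma crankExcess_diagonalPair (m : ℤ) (c : ℕ) :
    (if (diagonalPair m c).1 = 0 then crankExcess (diagonalPair m c).2 else 0) =
      if c = 0 then crankExcess m else 0 := by
  simp only [diagonalPair, crankExcess]
  split_ifs <;> omega

/-- The multisets of positive integers that, as partitions, have crank `m`. -/
def crankLevel (m : ℤ) : Set (Multiset ℕ) := ⋃ c, crankFiber (diagonalPair m c)

lemma crankLevel_subset (m : ℤ) : crankLevel m ⊆ partsIn (Set.Ici 1) :=
  Set.iUnion_subset fun _ => crankFiber_subset _

lemma mem_partsIn_of_partition {n : ℕ} (p : n.Partition) : p.parts ∈ partsIn (Set.Ici 1) :=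
  fun _ hi => p.parts_pos hi

lemma parts_mem_crankLevel_iff {n : ℕ} (p : n.Partition) (m : ℤ) :
    p.parts ∈ crankLevel m ↔ crank p = m := by
  rw [crank_eq_crankPair, ← exists_diagonalPair_eq_iff, crankLevel, Set.mem_iUnion]
  exact exists_congr fun c =>
    ⟨fun h => h.2.symm, fun h => ⟨mem_partsIn_of_partition p, h.symm⟩⟩

variable [CompleteSpace K]

lemma hasGenFun_crankLevel (hq : ‖q‖ < 1) (m : ℤ) :
    HasGenFun q (crankLevel m) (q ^ m.natAbs *
      (partialTheta q m.natAbs - q * partialTheta q (m.natAbs + 1)) / qPochhammerInf q +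
        q * crankExcess m) := by
  have hkernel := (((summable_durfeeTerm hq m.natAbs (m.natAbs + 2)).hasSum.mul_left
    (1 - q)).mul_left (q ^ m.natAbs)).add
      ((hasSum_ite_eq 0 (crankExcess m : K)).mul_left q)
  rw [← one_sub_mul_durfeeSum_mul hq, ← mul_assoc, mul_div_cancel_right₀ _
    (qPochhammerInf_ne_zero hq)]
  refine HasGenFun.iUnion hq (fun _ => crankFiber_subset _)
    (fun c d hcd => disjoint_crankFiber ((diagonalPair_injective m).ne hcd))
    (fun c => hasGenFun_crankFiber hq _) (hkernel.congr_fun fun c => ?_)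
  have hexcess := congrArg (Int.cast : ℤ → K) (crankExcess_diagonalPair m c)
  simp only [Int.cast_ite, Int.cast_zero] at hexcess
  rw [crankKernel_diagonalPair, hexcess]

lemma crank_partition_one (p : Nat.Partition 1) : crank p = -1 := by
  obtain rfl : p = default := Subsingleton.elim _ _
  decide

lemma natCard_crankLevel (m : ℤ) (n : ℕ) :
    (Nat.card {p : n.Partition // p.parts ∈ crankLevel m} : ℤ) =
      crankCount m n + if n = 1 then crankExcess m else 0 := by
  simp only [parts_mem_crankLevel_iff, Nat.card_eq_fintype_card, Fintype.card_subtype, crankCount]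
  rcases eq_or_ne n 1 with rfl | hn
  · simp only [crank_partition_one, Finset.filter_const, if_true, crankExcess]
    split_ifs <;> first | omega | simp
  · rw [if_neg hn, if_neg hn, add_zero]

/-- The Andrews-Garvan generating function of the crank. -/
lemma hasSum_crankCount (hq : ‖q‖ < 1) (m : ℤ) :
    HasSum (fun n : ℕ => (crankCount m n : K) * q ^ n) (q ^ m.natAbs *
      (partialTheta q m.natAbs - q * partialTheta q (m.natAbs + 1)) / qPochhammerInf q) := by
  have hcard := (hasGenFun_crankLevel hq m).hasSum_card_partition (crankLevel_subset m)
  have hexcess := (hasSum_ite_eq 1 (crankExcess m : K)).mul_left q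
  convert! hcard.sub hexcess using 1
  · funext n
    have hn : (Nat.card {p : n.Partition // p.parts ∈ crankLevel m} : K) =
        crankCount m n + if n = 1 then (crankExcess m : K) else 0 := by
      exact_mod_cast congrArg (Int.cast : ℤ → K) (natCard_crankLevel m n)
    rw [hn]
    split_ifs with h
    · subst h
      ring
    · ring
  · ring

end CrankGeneratingFunction

section CrankMoment

/-- The weight of crank `m` in the symmetrized crank moment of order `2 k`. -/
noncomputable def crankWeight (k : ℕ) (m : ℤ) : ℤ := Ring.choose (m + ((k : ℤ) - 1)) (2 * k)

lemma crankWeight_natCast {k : ℕ} (hk : 1 ≤ k) (n : ℕ) :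
    crankWeight k n = ((n + (k - 1)).choose (2 * k) : ℕ) := by
  rw [crankWeight, ← Ring.choose_natCast]
  push_cast [hk]
  rfl

lemma crankWeight_neg_natCast (k n : ℕ) :
    crankWeight k (-(n : ℤ)) = ((n + k).choose (2 * k) : ℕ) := by
  rw [crankWeight, show -(n : ℤ) + ((k : ℤ) - 1) = -((n : ℤ) + 1 - k) by ring, Ring.choose_neg,
    ← Ring.choose_natCast, Int.negOnePow_even _ (by simp), one_smul]
  congr 1
  push_cast
  ring

lemma crankWeight_zero {k : ℕ} (hk : 1 ≤ k) : crankWeight k 0 = 0 := by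
  have h := crankWeight_natCast hk 0
  rw [Nat.choose_eq_zero_of_lt (by omega)] at h
  simpa using h

lemma crankWeight_nonneg {k : ℕ} (hk : 1 ≤ k) (m : ℤ) : 0 ≤ crankWeight k m := by
  obtain ⟨n, rfl | rfl⟩ := m.eq_nat_or_neg
  · rw [crankWeight_natCast hk]
    positivity
  · rw [crankWeight_neg_natCast]
    positivity

lemma crank_mem_Icc {n : ℕ} (p : n.Partition) : crank p ∈ Finset.Icc (-(n : ℤ)) n := by
  have hcard : p.parts.card ≤ n := by
    simpa [p.parts_sum] using
      Multiset.card_nsmul_le_sum (s := p.parts) (a := 1) fun i hi => p.parts_pos hi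
  have hones := (Multiset.count_le_card 1 p.parts).trans hcard
  have hlarge := (Multiset.countP_le_card (fun i => p.parts.count 1 < i) p.parts).trans hcard
  have hsup : p.parts.sup ≤ n := Multiset.sup_le.mpr fun i hi => Nat.Partition.le_of_mem_parts hi
  rw [Finset.mem_Icc]
  unfold crank
  split_ifs <;> omega

lemma crankCount_eq_zero {m : ℤ} {n : ℕ} (hm : m ∉ Finset.Icc (-(n : ℤ)) n) :
    crankCount m n = 0 := by
  unfold crankCount
  split_ifs with hn hneg hzero hone
  · exact absurd (by simp [hn, hneg]) hm
  · exact absurd (by simp [hzero]) hm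
  · exact absurd (by simp [hn, hone]) hm
  · rfl
  · rw [Finset.filter_eq_empty_iff.mpr (fun p _ (hp : crank p = m) => hm (hp ▸ crank_mem_Icc p)),
      Finset.card_empty, Nat.cast_zero]

lemma crankWeight_mul_crankCount_nonneg {k : ℕ} (hk : 1 ≤ k) (m : ℤ) (n : ℕ) :
    0 ≤ crankWeight k m * crankCount m n := by
  rcases eq_or_ne m 0 with rfl | hm
  · simp [crankWeight_zero hk]
  · refine mul_nonneg (crankWeight_nonneg hk m) ?_
    unfold crankCount
    split_ifs <;> positivity

lemma symCrankMoment_two_mul (k n : ℕ) :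
    symCrankMoment (2 * k) n =
      ∑ m ∈ Finset.Icc (-(n : ℤ)) n, crankWeight k m * crankCount m n := by
  rw [symCrankMoment, show (((2 * k : ℕ) : ℤ) - 1) / 2 = (k : ℤ) - 1 by omega]
  rfl

lemma symCrankMoment_two_mul_zero {k : ℕ} (hk : 1 ≤ k) : symCrankMoment (2 * k) 0 = 0 := by
  simp [symCrankMoment_two_mul, crankWeight_zero hk]

lemma hasSum_swap_fiberwise {α β γ : Type*} [AddCommGroup α] [TopologicalSpace α]
    [IsTopologicalAddGroup α] [T2Space α] [RegularSpace α] {f : β × γ → α} {g : β → α} {h : γ → α}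
    {a : α} (hf : Summable f) (hrow : ∀ b, HasSum (fun c => f (b, c)) (g b))
    (hcol : ∀ c, HasSum (fun b => f (b, c)) (h c)) (hg : HasSum g a) : HasSum h a := by
  rw [hg.unique (hf.hasSum.prod_fiberwise hrow)]
  exact ((Equiv.prodComm γ β).hasSum_iff.mpr hf.hasSum).prod_fiberwise hcol

variable {K : Type*} [NormedField K]

lemma norm_intCast_le_of_nonneg {z : ℤ} (hz : 0 ≤ z) : ‖(z : K)‖ ≤ z := by
  have h := norm_zsmul_le z (1 : K)
  rwa [zsmul_one, norm_one, mul_one, Int.norm_eq_abs, abs_of_nonneg (Int.cast_nonneg hz)] at h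

lemma hasSum_symCrankMoment_fiber (q : K) (k n : ℕ) :
    HasSum (fun m : ℤ => (crankWeight k m : K) * crankCount m n * q ^ n)
      ((symCrankMoment (2 * k) n : K) * q ^ n) := by
  refine HasSum.mul_right _ ?_
  rw [symCrankMoment_two_mul, Int.cast_sum]
  simp only [← Int.cast_mul]
  exact hasSum_sum_of_ne_finset_zero fun m hm => by rw [crankCount_eq_zero hm, mul_zero,
    Int.cast_zero]

lemma hasSum_of_hasSum_nat_add {f : ℕ → K} {a : K} (N : ℕ) (hzero : ∀ n < N, f n = 0)
    (h : HasSum (fun n => f (n + N)) a) : HasSum f a := by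
  rwa [← hasSum_nat_add_iff' N, Finset.sum_eq_zero fun n hn => hzero n (Finset.mem_range.mp hn),
    sub_zero]

lemma hasSum_crankWeight_natCast {k : ℕ} (hk : 1 ≤ k) {x : K} (hx : ‖x‖ < 1) :
    HasSum (fun n : ℕ => (crankWeight k n : K) * x ^ n)
      (x ^ (k + 1) * (1 / (1 - x) ^ (2 * k + 1))) := by
  simp only [crankWeight_natCast hk, Int.cast_natCast]
  refine hasSum_of_hasSum_nat_add (k + 1) (fun n hn => ?_) ?_
  · rw [Nat.choose_eq_zero_of_lt (by omega), Nat.cast_zero, zero_mul]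
  · refine ((hasSum_choose_mul_geometric_of_norm_lt_one (2 * k) hx).mul_left
      (x ^ (k + 1))).congr_fun fun n => ?_
    rw [show n + (k + 1) + (k - 1) = n + 2 * k by omega]
    ring

lemma hasSum_crankWeight_neg {k : ℕ} (hk : 1 ≤ k) {x : K} (hx : ‖x‖ < 1) :
    HasSum (fun n : ℕ => (crankWeight k (-((n + 1 : ℕ) : ℤ)) : K) * x ^ (n + 1))
      (x ^ k * (1 / (1 - x) ^ (2 * k + 1))) := by
  simp only [crankWeight_neg_natCast, Int.cast_natCast]
  refine hasSum_of_hasSum_nat_add (k - 1) (fun n hn => ?_) ?_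
  · rw [Nat.choose_eq_zero_of_lt (by omega), Nat.cast_zero, zero_mul]
  · refine ((hasSum_choose_mul_geometric_of_norm_lt_one (2 * k) hx).mul_left
      (x ^ k)).congr_fun fun n => ?_
    rw [show n + (k - 1) + 1 + k = n + 2 * k by omega, show n + (k - 1) + 1 = n + k by omega]
    ring

lemma hasSum_crankWeight {k : ℕ} (hk : 1 ≤ k) {x : K} (hx : ‖x‖ < 1) :
    HasSum (fun m : ℤ => (crankWeight k m : K) * x ^ m.natAbs)
      (x ^ k * (1 + x) / (1 - x) ^ (2 * k + 1)) := by
  rw [show x ^ k * (1 + x) / (1 - x) ^ (2 * k + 1) =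
    x ^ (k + 1) * (1 / (1 - x) ^ (2 * k + 1)) + x ^ k * (1 / (1 - x) ^ (2 * k + 1)) by ring]
  refine HasSum.of_nat_of_neg_add_one (hasSum_crankWeight_natCast hk hx) ?_
  refine (hasSum_crankWeight_neg hk hx).congr_fun fun n => ?_
  rw [← Nat.cast_succ, Int.natAbs_neg, Int.natAbs_natCast]

lemma summable_crankWeight_mul_crankCount_real {k : ℕ} (hk : 1 ≤ k) {r : ℝ} (hr0 : 0 ≤ r)
    (hr : r < 1) :
    Summable fun x : ℤ × ℕ => (crankWeight k x.1 : ℝ) * crankCount x.1 x.2 * r ^ x.2 := by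
  have hnorm : ‖r‖ < 1 := by rwa [Real.norm_of_nonneg hr0]
  have hrow : ∀ m : ℤ, HasSum (fun n => (crankWeight k m : ℝ) * crankCount m n * r ^ n) _ :=
    fun m => by simpa only [mul_assoc] using (hasSum_crankCount hnorm m).mul_left _
  refine (summable_prod_of_nonneg fun x => ?_).mpr ⟨fun m => (hrow m).summable, ?_⟩
  · rw [← Int.cast_mul]
    exact mul_nonneg (Int.cast_nonneg (crankWeight_mul_crankCount_nonneg hk x.1 x.2))
      (pow_nonneg hr0 _)
  simp only [fun m => (hrow m).tsum_eq]
  refine Summable.of_norm_bounded ((hasSum_crankWeight hk hnorm).summable.norm.mul_right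
    (((1 - ‖r‖)⁻¹ + ‖r‖ * (1 - ‖r‖)⁻¹) / ‖qPochhammerInf r‖)) fun m => ?_
  rw [← mul_div_assoc, ← mul_assoc, norm_div, norm_mul _ (_ - _), ← mul_div_assoc]
  gcongr
  refine (norm_sub_le _ _).trans (add_le_add (norm_partialTheta_le hnorm _) ?_)
  rw [norm_mul]
  exact mul_le_mul_of_nonneg_left (norm_partialTheta_le hnorm _) (norm_nonneg _)

variable [CompleteSpace K] {q : K}

lemma summable_crankWeight_mul_crankCount {k : ℕ} (hk : 1 ≤ k) (hq : ‖q‖ < 1) :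
    Summable fun x : ℤ × ℕ => (crankWeight k x.1 : K) * crankCount x.1 x.2 * q ^ x.2 := by
  refine Summable.of_norm_bounded
    (summable_crankWeight_mul_crankCount_real hk (norm_nonneg q) hq) fun x => ?_
  rw [norm_mul, norm_pow, ← Int.cast_mul, ← Int.cast_mul]
  gcongr
  exact norm_intCast_le_of_nonneg (crankWeight_mul_crankCount_nonneg hk x.1 x.2)

end CrankMoment

section LambertSeries

variable {K : Type*} [NormedField K] {q : K}

/-- The summand `(-1) ^ n q ^ (n (n + 1) / 2 + k (n + 1)) / (1 - q ^ (n + 1)) ^ (2 k)` of a Lambert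
series. The terms of index `n + 1` and `-(n + 1)` of the two-sided series are
`q ^ (n + 1) * lambertTerm q k n` and `lambertTerm q k n`. -/
def lambertTerm (q : K) (k n : ℕ) : K :=
  (-1) ^ n * q ^ (n * (n + 1) / 2 + k * (n + 1)) / (1 - q ^ (n + 1)) ^ (2 * k)

lemma summable_norm_lambertTerm (k : ℕ) (hq : ‖q‖ < 1) :
    Summable fun n => ‖lambertTerm q k n‖ := by
  have hpos : 0 < (1 - ‖q‖) ^ (2 * k) := pow_pos (sub_pos.mpr hq) _
  refine Summable.of_nonneg_of_le (fun _ => norm_nonneg _) (fun n => ?_)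
    ((summable_geometric_of_lt_one (norm_nonneg q) hq).mul_right ((1 - ‖q‖) ^ (2 * k))⁻¹)
  have hle : 1 - ‖q‖ ≤ ‖1 - q ^ (n + 1)‖ := by
    have hpow := norm_pow_le_norm_pow hq (Nat.le_add_left 1 n)
    have hsub := norm_sub_norm_le 1 (q ^ (n + 1))
    rw [pow_one] at hpow
    rw [norm_one] at hsub
    linarith
  rw [lambertTerm, norm_div, div_eq_mul_inv, norm_pow (1 - _)]
  exact mul_le_mul (norm_neg_one_pow_mul_pow_le hq _ n)
    (inv_anti₀ hpos (pow_le_pow_left₀ (sub_nonneg.mpr hq.le) hle _))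
    (inv_nonneg.mpr (pow_nonneg (norm_nonneg _) _)) (pow_nonneg (norm_nonneg _) _)

/-- The sum `∑_{n ≥ 1} (-1) ^ (n - 1) q ^ (n (n - 1) / 2 + k n) (1 + q ^ n) / (1 - q ^ n) ^ (2 k)`,
split into the contributions of the positive and the negative indices of its two-sided form. -/
noncomputable def lambertSum (q : K) (k : ℕ) : K :=
  ∑' n, q ^ (n + 1) * lambertTerm q k n + ∑' n, lambertTerm q k n

lemma intCast_mul_succ_div_two (n : ℕ) : (n : ℤ) * (n + 1) / 2 = (n * (n + 1) / 2 : ℕ) := by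
  push_cast
  rfl

lemma lambert_summand_natCast_add_one (q : K) (k n : ℕ) :
    (-1) ^ ((n : ℤ) + 1 - 1) * q ^ (((n : ℤ) + 1) * (n + 1 + 1) / 2 + k * (n + 1)) /
      (1 - q ^ ((n : ℤ) + 1)) ^ (2 * k) = q ^ (n + 1) * lambertTerm q k n := by
  have hexp : ((n : ℤ) + 1) * (n + 1 + 1) / 2 + k * (n + 1) =
      (n * (n + 1) / 2 + k * (n + 1) + (n + 1) : ℕ) := by
    rw [← Nat.cast_succ, intCast_mul_succ_div_two, succ_mul_add_two_div_two]
    push_cast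
    ring
  rw [hexp, add_sub_cancel_right, ← Nat.cast_succ, zpow_natCast, zpow_natCast, zpow_natCast,
    lambertTerm, pow_add q _ (n + 1), Nat.succ_eq_add_one]
  ring

lemma lambert_summand_neg_natCast_add_one (hq0 : q ≠ 0) (k n : ℕ) :
    (-1) ^ (-((n : ℤ) + 1) - 1) *
      q ^ (-((n : ℤ) + 1) * (-((n : ℤ) + 1) + 1) / 2 + k * -((n : ℤ) + 1)) /
      (1 - q ^ (-((n : ℤ) + 1))) ^ (2 * k) = lambertTerm q k n := by
  have hexp : -((n : ℤ) + 1) * (-((n : ℤ) + 1) + 1) / 2 + k * -((n : ℤ) + 1) =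
      (n * (n + 1) / 2 + k * (n + 1) : ℕ) - (2 * k * (n + 1) : ℕ) := by
    rw [show -((n : ℤ) + 1) * (-((n : ℤ) + 1) + 1) = n * (n + 1) by ring,
      intCast_mul_succ_div_two]
    push_cast
    ring
  have hsign : (-1 : K) ^ (-((n : ℤ) + 1) - 1) = (-1) ^ n := by
    rw [show -((n : ℤ) + 1) - 1 = -((n + 2 : ℕ) : ℤ) by push_cast; ring, zpow_neg, zpow_natCast,
      ← inv_pow, inv_neg, inv_one, pow_add, neg_one_sq, mul_one]
  have hdenom : (1 - q ^ (-((n : ℤ) + 1))) ^ (2 * k) =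
      (1 - q ^ (n + 1)) ^ (2 * k) / q ^ (2 * k * (n + 1)) := by
    rw [← Nat.cast_succ, zpow_neg, zpow_natCast, mul_comm (2 * k) (n + 1), pow_mul q, ← div_pow,
      ← (even_two_mul k).neg_pow]
    congr 1
    field_simp
    ring
  have hpow : q ^ (2 * k * (n + 1)) ≠ 0 := pow_ne_zero _ hq0
  rw [hexp, hsign, hdenom, zpow_sub₀ hq0, zpow_natCast, zpow_natCast, lambertTerm]
  field_simp

lemma hasSum_int_ne_zero {f : ℤ → K} {a b : K} (hpos : HasSum (fun n : ℕ => f (n + 1)) a)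
    (hneg : HasSum (fun n : ℕ => f (-(n + 1))) b) :
    HasSum (fun n : {n : ℤ // n ≠ 0} => f n) (a + b) := by
  refine (hasSum_subtype_iff_indicator (s := {n : ℤ | n ≠ 0})).mpr
    (HasSum.of_nat_of_neg_add_one ?_ ?_)
  · refine hasSum_of_hasSum_nat_add 1 (fun n hn => by simp [Nat.lt_one_iff.mp hn]) ?_
    refine hpos.congr_fun fun n => ?_
    rw [Set.indicator_of_mem (Nat.cast_ne_zero.mpr n.succ_ne_zero), Nat.cast_succ]
  · refine hneg.congr_fun fun n => ?_
    rw [Set.indicator_of_mem (neg_ne_zero.mpr n.cast_add_one_ne_zero)]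

variable [CompleteSpace K]

lemma summable_pow_succ_mul_lambertTerm (k : ℕ) (hq : ‖q‖ < 1) :
    Summable fun n => q ^ (n + 1) * lambertTerm q k n :=
  Summable.of_norm_bounded (summable_norm_lambertTerm k hq) fun n => by
    rw [norm_mul]
    exact mul_le_of_le_one_left (norm_nonneg _) (norm_pow_lt_one hq n.succ_ne_zero).le

lemma hasSum_lambertSum (k : ℕ) (hq : ‖q‖ < 1) :
    HasSum (fun n => (1 + q ^ (n + 1)) * lambertTerm q k n) (lambertSum q k) :=
  ((summable_pow_succ_mul_lambertTerm k hq).hasSum.add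
    (summable_norm_lambertTerm k hq).of_norm.hasSum).congr_fun fun n => by ring

lemma hasSum_lambertSum_pnat (k : ℕ) (hq : ‖q‖ < 1) :
    HasSum (fun n : ℕ+ =>
      (-1) ^ ((n : ℕ) - 1) * q ^ ((n : ℕ) * ((n : ℕ) - 1) / 2 + k * (n : ℕ)) *
        ((1 + q ^ (n : ℕ)) / (1 - q ^ (n : ℕ)) ^ (2 * k))) (lambertSum q k) := by
  refine (hasSum_pnat_iff_hasSum_succ (f := fun n : ℕ => (-1) ^ (n - 1) *
    q ^ (n * (n - 1) / 2 + k * n) * ((1 + q ^ n) / (1 - q ^ n) ^ (2 * k)))).mpr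
    ((hasSum_lambertSum k hq).congr_fun fun n => ?_)
  rw [Nat.add_sub_cancel, mul_comm (n + 1) n, lambertTerm]
  ring

lemma hasSum_lambertSum_int (k : ℕ) (hq : ‖q‖ < 1) (hq0 : q ≠ 0) :
    HasSum (fun n : {n : ℤ // n ≠ 0} =>
      (-1) ^ ((n : ℤ) - 1) * q ^ ((n : ℤ) * ((n : ℤ) + 1) / 2 + (k : ℤ) * (n : ℤ)) /
        (1 - q ^ (n : ℤ)) ^ (2 * k)) (lambertSum q k) :=
  hasSum_int_ne_zero (f := fun n : ℤ => (-1) ^ (n - 1) * q ^ (n * (n + 1) / 2 + (k : ℤ) * n) /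
      (1 - q ^ n) ^ (2 * k))
    ((summable_pow_succ_mul_lambertTerm k hq).hasSum.congr_fun
      (lambert_summand_natCast_add_one q k))
    ((summable_norm_lambertTerm k hq).of_norm.hasSum.congr_fun
      (lambert_summand_neg_natCast_add_one hq0 k))

end LambertSeries

section MomentGeneratingFunction

variable {K : Type*} [NormedField K] {q : K}

/-- The general term of the double series obtained by inserting the partial theta series into
`∑ₘ crankWeight k m * q ^ |m| * (partialTheta q |m| - q * partialTheta q (|m| + 1))`. -/
noncomputable def crankThetaTerm (q : K) (k : ℕ) (x : ℤ × ℕ) : K :=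
  crankWeight k x.1 * (q ^ x.1.natAbs *
    ((-1) ^ x.2 * q ^ (x.2 * (x.2 + 1) / 2 + x.2 * x.1.natAbs) * (1 - q ^ (x.2 + 1))))

lemma hasSum_crankThetaTerm_fst {k : ℕ} (hk : 1 ≤ k) (hq : ‖q‖ < 1) (n : ℕ) :
    HasSum (fun m : ℤ => crankThetaTerm q k (m, n)) ((1 + q ^ (n + 1)) * lambertTerm q k n) := by
  have hne := one_sub_pow_ne_zero hq n.succ_ne_zero
  have hsum := (hasSum_crankWeight hk (norm_pow_lt_one hq n.succ_ne_zero)).mul_left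
    ((-1) ^ n * q ^ (n * (n + 1) / 2) * (1 - q ^ (n + 1)))
  have hvalue : (1 + q ^ (n + 1)) * lambertTerm q k n =
      (-1) ^ n * q ^ (n * (n + 1) / 2) * (1 - q ^ (n + 1)) * ((q ^ (n + 1)) ^ k *
        (1 + q ^ (n + 1)) / (1 - q ^ (n + 1)) ^ (2 * k + 1)) := by
    rw [lambertTerm, ← pow_mul, mul_comm (n + 1) k, pow_add q (_ / 2),
      pow_succ (1 - q ^ (n + 1))]
    field_simp
  rw [hvalue]
  refine hsum.congr_fun fun m => ?_
  rw [crankThetaTerm, Nat.succ_eq_add_one]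
  ring

variable [CompleteSpace K]

lemma summable_crankThetaTerm {k : ℕ} (hk : 1 ≤ k) (hq : ‖q‖ < 1) :
    Summable (crankThetaTerm q k) := by
  have hweight : Summable fun m : ℤ => (crankWeight k m : ℝ) * ‖q‖ ^ m.natAbs :=
    (hasSum_crankWeight hk (by rwa [norm_norm])).summable
  have hweight_nonneg : ∀ m, (0 : ℝ) ≤ crankWeight k m := fun m =>
    Int.cast_nonneg (crankWeight_nonneg hk m)
  refine Summable.of_norm_bounded ((hweight.mul_of_nonneg (summable_geometric_of_lt_one
    (norm_nonneg q) hq) (fun m => mul_nonneg (hweight_nonneg m) (by positivity))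
    fun _ => by positivity).mul_right 2) fun x => ?_
  rw [crankThetaTerm, norm_mul, norm_mul, norm_mul _ (1 - _), norm_pow q, mul_assoc, mul_assoc]
  gcongr
  · exact hweight_nonneg x.1
  · exact norm_intCast_le_of_nonneg (crankWeight_nonneg hk _)
  · exact norm_neg_one_pow_mul_pow_le hq _ _
  · refine (norm_sub_le _ _).trans ?_
    rw [norm_one, ← one_add_one_eq_two]
    exact add_le_add_right (norm_pow_lt_one hq x.2.succ_ne_zero).le _

lemma hasSum_crankWeight_mul_partialTheta {k : ℕ} (hk : 1 ≤ k) (hq : ‖q‖ < 1) :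
    HasSum (fun m : ℤ => (crankWeight k m : K) *
      (q ^ m.natAbs * (partialTheta q m.natAbs - q * partialTheta q (m.natAbs + 1))))
      (lambertSum q k) :=
  hasSum_swap_fiberwise
    ((Equiv.prodComm ℕ ℤ).summable_iff.mpr (summable_crankThetaTerm hk hq))
    (hasSum_crankThetaTerm_fst hk hq)
    (fun m => ((hasSum_partialTheta_sub hq m.natAbs).mul_left _).mul_left _)
    (hasSum_lambertSum k hq)

lemma hasSum_symCrankMoment {k : ℕ} (hk : 1 ≤ k) (hq : ‖q‖ < 1) :
    HasSum (fun n : ℕ => (symCrankMoment (2 * k) n : K) * q ^ n)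
      (lambertSum q k / qPochhammerInf q) :=
  hasSum_swap_fiberwise (summable_crankWeight_mul_crankCount hk hq)
    (fun m => by
      simpa only [mul_assoc] using (hasSum_crankCount hq m).mul_left (crankWeight k m : K))
    (hasSum_symCrankMoment_fiber q k)
    (((hasSum_crankWeight_mul_partialTheta hk hq).div_const _).congr_fun fun m => by ring)

lemma hasSum_symCrankMoment_pnat {k : ℕ} (hk : 1 ≤ k) (hq : ‖q‖ < 1) :
    HasSum (fun n : ℕ+ => (symCrankMoment (2 * k) n : K) * q ^ (n : ℕ))
      (lambertSum q k / qPochhammerInf q) := by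
  rw [hasSum_pnat_iff (f := fun n : ℕ => (symCrankMoment (2 * k) n : K) * q ^ n),
    symCrankMoment_two_mul_zero hk, Int.cast_zero, zero_mul, add_zero]
  exact hasSum_symCrankMoment hk hq

end MomentGeneratingFunction

theorem mainTheorem6_general {K : Type*} [NormedField K] [CompleteSpace K] (k : ℕ) (hk : 1 ≤ k)
    (q : K) (hq : ‖q‖ < 1) :
    (Multipliable (fun n : ℕ+ => 1 - q ^ (n : ℕ)) ∧ qPochhammerInf q ≠ 0) ∧
    (Summable (fun n : ℕ+ => (symCrankMoment (2 * k) (n : ℕ) : K) * q ^ (n : ℕ)) ∧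
      Summable (fun n : ℕ+ =>
        (-1 : K) ^ ((n : ℕ) - 1) * q ^ ((n : ℕ) * ((n : ℕ) - 1) / 2 + k * (n : ℕ)) *
          ((1 + q ^ (n : ℕ)) / (1 - q ^ (n : ℕ)) ^ (2 * k))) ∧
      ∑' n : ℕ+, (symCrankMoment (2 * k) (n : ℕ) : K) * q ^ (n : ℕ) =
        1 / qPochhammerInf q * ∑' n : ℕ+,
          (-1 : K) ^ ((n : ℕ) - 1) * q ^ ((n : ℕ) * ((n : ℕ) - 1) / 2 + k * (n : ℕ)) *
            ((1 + q ^ (n : ℕ)) / (1 - q ^ (n : ℕ)) ^ (2 * k))) ∧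
    (q ≠ 0 →
      Summable (fun n : {n : ℤ // n ≠ 0} =>
        (-1 : K) ^ ((n : ℤ) - 1) * q ^ ((n : ℤ) * ((n : ℤ) + 1) / 2 + (k : ℤ) * (n : ℤ)) /
          (1 - q ^ (n : ℤ)) ^ (2 * k)) ∧
      ∑' n : ℕ+, (symCrankMoment (2 * k) (n : ℕ) : K) * q ^ (n : ℕ) =
        1 / qPochhammerInf q * ∑' n : {n : ℤ // n ≠ 0},
          (-1 : K) ^ ((n : ℤ) - 1) * q ^ ((n : ℤ) * ((n : ℤ) + 1) / 2 + (k : ℤ) * (n : ℤ)) /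
            (1 - q ^ (n : ℤ)) ^ (2 * k)) := by
  have hmoment := hasSum_symCrankMoment_pnat hk hq
  have hone := hasSum_lambertSum_pnat k hq
  refine ⟨⟨multipliable_one_sub_pow_pnat hq, qPochhammerInf_ne_zero hq⟩,
    ⟨hmoment.summable, hone.summable, ?_⟩, fun hq0 => ?_⟩
  · rw [hmoment.tsum_eq, hone.tsum_eq, one_div_mul_eq_div]
  · have htwo := hasSum_lambertSum_int k hq hq0
    exact ⟨htwo.summable, by rw [hmoment.tsum_eq, htwo.tsum_eq, one_div_mul_eq_div]⟩

theorem mainTheorem6 (k : ℕ) (hk : 1 ≤ k) (q : ℂ) (hq : ‖q‖ < 1) :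
    (Multipliable (fun n : ℕ+ => 1 - q ^ (n : ℕ)) ∧ eulerProd q ≠ 0) ∧
    (Summable (fun n : ℕ+ => (symCrankMoment (2 * k) (n : ℕ) : ℂ) * q ^ (n : ℕ)) ∧
      Summable (fun n : ℕ+ =>
        (-1 : ℂ) ^ ((n : ℕ) - 1) * q ^ ((n : ℕ) * ((n : ℕ) - 1) / 2 + k * (n : ℕ)) *
          ((1 + q ^ (n : ℕ)) / (1 - q ^ (n : ℕ)) ^ (2 * k))) ∧
      ∑' n : ℕ+, (symCrankMoment (2 * k) (n : ℕ) : ℂ) * q ^ (n : ℕ) =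
        1 / eulerProd q * ∑' n : ℕ+,
          (-1 : ℂ) ^ ((n : ℕ) - 1) * q ^ ((n : ℕ) * ((n : ℕ) - 1) / 2 + k * (n : ℕ)) *
            ((1 + q ^ (n : ℕ)) / (1 - q ^ (n : ℕ)) ^ (2 * k))) ∧
    (q ≠ 0 →
      Summable (fun n : {n : ℤ // n ≠ 0} =>
        (-1 : ℂ) ^ ((n : ℤ) - 1) * q ^ ((n : ℤ) * ((n : ℤ) + 1) / 2 + (k : ℤ) * (n : ℤ)) /
          (1 - q ^ (n : ℤ)) ^ (2 * k)) ∧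
      ∑' n : ℕ+, (symCrankMoment (2 * k) (n : ℕ) : ℂ) * q ^ (n : ℕ) =
        1 / eulerProd q * ∑' n : {n : ℤ // n ≠ 0},
          (-1 : ℂ) ^ ((n : ℤ) - 1) * q ^ ((n : ℤ) * ((n : ℤ) + 1) / 2 + (k : ℤ) * (n : ℤ)) /
            (1 - q ^ (n : ℤ)) ^ (2 * k)) :=
  mainTheorem6_general k hk q hq
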